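/- Let $V$ be a finite-dimensional real Euclidean space with inner product $\langle\cdot,\cdot\rangle$, and for $0\neq\alpha\in V$ let $s_\alpha$ be the orthogonal reflection $s_\alpha(v)=v-\frac{2\langle v,\alpha\rangle}{\langle\alpha,\alpha\rangle}\alpha$. Let $\Phi\subset V\setminus\{0\}$ be a root system, i.e. a finite set with $s_\alpha(\beta)\in\Phi$ for all $\alpha,\beta\in\Phi$ and such that $\alpha,c\alpha\in\Phi$ with $c\in\mathbb R$ implies $c=\pm1$ ($\Phi$ need neither span $V$ nor be crystallographic). A simple system of $\Phi$ is a linearly independent subset $\Pi\subseteq\Phi$ such that $\Phi$ is the disjoint union of $\Phi_+:=\Phi\cap\mathbb R_{\ge0}\Pi$ and $-\Phi_+$; fix one. Let $W$ be the group generated by all $s_\alpha$, $\alpha\in\Phi$, and let $S=\{s_\alpha\mid\alpha\in\Pi\}$. For $I\subseteq S$ put $W_I=\langle I\rangle$ and $\Pi_I=\{\alpha\in\Pi\mid s_\alpha\in I\}$. For a subgroup $W'$ of $W$ generated by reflections $s_\alpha$ ($\alpha\in\Phi$), the root system $\Phi_{W'}=\{\alpha\in\Phi\mid s_\alpha\in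 W'\}$ has a unique simple system $\Pi_{W'}$ contained in $\Phi_+$; put $\mathcal C_{W'}=\{v\in V\mid\langle v,\alpha\rangle\ge0\text{ for all }\alpha\in\Pi_{W'}\}$. Let $n\ge1$ and let $W$ act diagonally on $V^n$. For $\mathbf v=(v_1,\dots,v_n)\in V^n$ and $0\le m\le n$ let $W_{\mathbf v,m}$ be the stabiliser in $W$ of $(v_1,\dots,v_m)$ (a subgroup generated by reflections), and let $$\mathcal C^{(n)}=\{\mathbf v\in V^n\mid v_m\in\mathcal C_{W_{\mathbf v,m-1}}\text{ for }m=1,\dots,n\}.$$ For $J\subseteq I\subseteq S$ let $$\mathcal C_{I,J}=\{v\in V\mid\langle\alpha,v\rangle=0\text{ for }\alpha\in\Pi_J,\ \langle\alpha,v\rangle>0\text{ for }\alpha\in\Pi_{I\setminus J}\}.$$ Let $\mathcal I^{(n)}$ be the set of sequences $\mathbf I=(I_0,\dots,I_n)$ of subsets of $S$ with $S=I_0\supseteq I_1\supseteq\dots\supseteq I_n$, and for $\mathbf I\in\mathcal I^{(n)}$ let $$\mathcal X_{\mathbf I}=\mathcal C_{I_0,I_1}\times\mathcal C_{I_1,I_2}\times\dots\times\mathcal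 C_{I_{n-1},I_n}\subseteq V^n.$$ The sets $w(\mathcal X_{\mathbf I})$ with $w\in W$, $\mathbf I\in\mathcal I^{(n)}$ are called the strata of $V^n$. Then: (a) If $\mathbf I\in\mathcal I^{(n)}$, then $\mathcal X_{\mathbf I}\subseteq\mathcal C^{(n)}$. (b) If $\mathbf I\in\mathcal I^{(n)}$, $w\in W$ and $\mathbf v\in w(\mathcal X_{\mathbf I})$, then $\mathrm{Stab}_W(\mathbf v)=wW_{I_n}w^{-1}$. (c) For $v,w\in W$ and $\mathbf I,\mathbf J\in\mathcal I^{(n)}$ the following are equivalent: (i) $v(\mathcal X_{\mathbf I})\cap w(\mathcal X_{\mathbf J})\ne\emptyset$; (ii) $v(\mathcal X_{\mathbf I})=w(\mathcal X_{\mathbf J})$; (iii) $\mathbf I=\mathbf J$ and $v^{-1}w\in W_{I_n}$. (d) If $\mathbf I\in\mathcal I^{(n)}$ and $w\in W$, then the setwise stabiliser of $w(\mathcal X_{\mathbf I})$ in $W$ is $wW_{I_n}w^{-1}$. (e) Each of the sets $\mathcal C^{(n)}$ and $V^n$ is the disjoint union of the strata that it contains. (f) The topological closure of any stratum of $V^n$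 is a union of strata. -/

import Mathlib

open scoped Pointwise

noncomputable section

namespace DiagonalStrata

variable {V : Type*} [NormedAddCommGroup V] [InnerProductSpace ℝ V]

/-- The orthogonal reflection `s_α` in the hyperplane orthogonal to `α`. -/
def refl (α : V) : V ≃ₗ[ℝ] V := ((ℝ ∙ α)ᗮ.reflection).toLinearEquiv

/-- The usual formula `s_α(v) = v - ⟨v, α^∨⟩ α`, where `α^∨ = (2 / ⟨α, α⟩) α`. -/
theorem refl_apply (α v : V) :
    refl α v = v - (inner ℝ v ((2 / inner ℝ α α) • α)) • α := by
  have h : refl α v = (ℝ ∙ α)ᗮ.reflection v := rfl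
  have h2 : (2 : ℕ) • ((inner ℝ α v / ‖α‖ ^ 2) • α) = (2 * (inner ℝ α v / ‖α‖ ^ 2)) • α := by
    rw [two_nsmul, ← add_smul, two_mul]
  have h3 : inner ℝ v ((2 / inner ℝ α α) • α) = 2 * (inner ℝ α v / ‖α‖ ^ 2) := by
    rw [inner_smul_right, real_inner_self_eq_norm_sq, real_inner_comm]
    ring
  rw [h, Submodule.reflection_orthogonal_apply, Submodule.reflection_singleton_apply, h3, neg_sub]
  exact congrArg (v - ·) h2

/-- A (finite, reduced, not necessarily crystallographic, not necessarily spanning) root system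
in the Euclidean space `V`. -/
structure IsRootSystem (Φ : Set V) : Prop where
  finite : Φ.Finite
  zero_notMem : (0 : V) ∉ Φ
  refl_mem : ∀ α ∈ Φ, ∀ β ∈ Φ, refl α β ∈ Φ
  reduced : ∀ α ∈ Φ, ∀ c : ℝ, c • α ∈ Φ → c = 1 ∨ c = -1

/-- `Φ₊ = Φ ∩ ℝ_{≥ 0} Δ`. -/
def posRoots (Φ Δ : Set V) : Set V := Φ ∩ (PointedCone.hull ℝ Δ : Set V)

/-- `Δ` is a simple system of `Φ`: a linearly independent subset of `Φ` such that `Φ` is the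
disjoint union of `Φ₊ = Φ ∩ ℝ_{≥ 0} Δ` and `Φ₋ = -Φ₊`. -/
structure IsSimpleSystem (Φ Δ : Set V) : Prop where
  subset : Δ ⊆ Φ
  linearIndepOn : LinearIndepOn ℝ id Δ
  union_eq : posRoots Φ Δ ∪ -posRoots Φ Δ = Φ
  disjoint : Disjoint (posRoots Φ Δ) (-posRoots Φ Δ)

/-- The group `W` generated by the reflections in the roots. It acts on `V`, diagonally on
`Fin n → V`, and elementwise on subsets of these. -/
def reflGroup (Φ : Set V) : Subgroup (V ≃ₗ[ℝ] V) := Subgroup.closure (refl '' Φ)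

/-- The set `S` of simple reflections, as a subset of `W`. -/
def simpleRefls (Φ Δ : Set V) : Set (reflGroup Φ) := {s | ∃ α ∈ Δ, (s : V ≃ₗ[ℝ] V) = refl α}

/-- For `I ⊆ S`, the set `Δ_I` of simple roots `α` with `s_α ∈ I`. -/
def simpleRootsOf {Φ : Set V} (Δ : Set V) (I : Set (reflGroup Φ)) : Set V :=
  {α ∈ Δ | ∃ s ∈ I, (s : V ≃ₗ[ℝ] V) = refl α}

/-- For `I ⊆ S`, the standard parabolic subgroup `W_I` generated by `I`. -/
def parabolic {Φ : Set V} (I : Set (reflGroup Φ)) : Subgroup (reflGroup Φ) := Subgroup.closure I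

/-- The root system `Φ_{W'} = {α ∈ Φ | s_α ∈ W'}` of a reflection subgroup `W'` of `W`. -/
def subRoots {Φ : Set V} (W' : Subgroup (reflGroup Φ)) : Set V :=
  {α ∈ Φ | ∃ s ∈ W', (s : V ≃ₗ[ℝ] V) = refl α}

/-- The simple system of `Φ_{W'}` contained in `Φ₊`. There is exactly one such simple system, so
that the union is over a single set. -/
def subSimple {Φ : Set V} (Δ : Set V) (W' : Subgroup (reflGroup Φ)) : Set V :=
  ⋃₀ {Γ | IsSimpleSystem (subRoots W') Γ ∧ Γ ⊆ posRoots Φ Δ}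

/-- The fundamental chamber `C_{W'}` of a reflection subgroup `W'` of `W`. -/
def chamber {Φ : Set V} (Δ : Set V) (W' : Subgroup (reflGroup Φ)) : Set V :=
  {v | ∀ α ∈ subSimple Δ W', 0 ≤ inner ℝ v α}

/-- `W_{v, m}`, the stabiliser in `W` of the first `m` entries of `v`. -/
def truncStab (Φ : Set V) {n : ℕ} (v : Fin n → V) (m : ℕ) : Subgroup (reflGroup Φ) :=
  ⨅ i : Fin n, ⨅ _ : (i : ℕ) < m, MulAction.stabilizer (reflGroup Φ) (v i)

/-- The fundamental region `C^(n)` for the diagonal action of `W` on `V^n`. The entries are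
numbered from `0`, so that the entry `v m` is preceded by exactly `m` entries. -/
def fundRegion (Φ Δ : Set V) (n : ℕ) : Set (Fin n → V) :=
  {v | ∀ m : Fin n, v m ∈ chamber Δ (truncStab Φ v m)}

/-- The facet `C_{I,J}`, for `J ⊆ I ⊆ S`. -/
def facet {Φ : Set V} (Δ : Set V) (I J : Set (reflGroup Φ)) : Set V :=
  {v | (∀ α ∈ simpleRootsOf Δ J, inner ℝ α v = 0) ∧
    ∀ α ∈ simpleRootsOf Δ (I \ J), 0 < inner ℝ α v}

/-- The sequences `S = I_0 ⊇ I_1 ⊇ ⋯ ⊇ I_n`. -/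
def chains (Φ Δ : Set V) (n : ℕ) : Set (Fin (n + 1) → Set (reflGroup Φ)) :=
  {I | I 0 = simpleRefls Φ Δ ∧ Antitone I}

/-- `X_I = C_{I_0,I_1} × C_{I_1,I_2} × ⋯ × C_{I_{n-1},I_n}`. -/
def cell {Φ : Set V} (Δ : Set V) {n : ℕ} (I : Fin (n + 1) → Set (reflGroup Φ)) :
    Set (Fin n → V) :=
  Set.univ.pi fun i : Fin n => facet Δ (I i.castSucc) (I i.succ)

/-- The set of all strata `w(X_I)` of `V^n`. -/
def strata (Φ Δ : Set V) (n : ℕ) : Set (Set (Fin n → V)) :=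
  {F | ∃ w : reflGroup Φ, ∃ I ∈ chains Φ Δ n, F = w • cell Δ I}

/-- `A` is the disjoint union of the strata it contains. -/
def IsDisjointUnionOfStrata (Φ Δ : Set V) {n : ℕ} (A : Set (Fin n → V)) : Prop :=
  ⋃₀ {F ∈ strata Φ Δ n | F ⊆ A} = A ∧ {F ∈ strata Φ Δ n | F ⊆ A}.PairwiseDisjoint id

end DiagonalStrata

end

/-!
Pair a vector `α` of `V` with a tuple `v` to get the tuple of inner products `⟪α, v i⟫`, ordered
lexicographically. With respect to this pairing the diagonal action on `V^n` behaves like the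
action on `V` itself: `C^(n)` is the set of tuples pairing nonnegatively with all simple roots. By
the exchange condition such a tuple is the only one of its kind in its orbit, and its stabilizer is
generated by the simple reflections fixing it. The cell containing a dominant tuple records the
stabilizers of the truncations of the tuple, which gives the disjointness statements.

For the closure, a root that pairs to zero with a dominant tuple lies in the cone over the simple
roots that pair to zero with it. Hence the sign of every root on every truncation is constant on
a cell, and whether a tuple lies in the closure of a given stratum depends only on its own stratum.
-/

namespace DiagonalStrata

open scoped RealInnerProductSpace

section Hull

variable {R E M : Type*} [Semiring R] [PartialOrder R] [IsOrderedRing R]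
  [AddCommMonoid E] [Module R E]
  [AddCommMonoid M] [PartialOrder M] [IsOrderedAddMonoid M] [Module R M] [PosSMulMono R M]
  {A : Set E} {f : E →ₗ[R] M} {x : E}

theorem map_nonneg_of_mem_hull (hf : ∀ a ∈ A, 0 ≤ f a) (hx : x ∈ PointedCone.hull R A) :
    0 ≤ f x := by
  have h : PointedCone.hull R A ≤ (PointedCone.positive R M).comap f := Submodule.span_le.2 hf
  exact h hx

theorem mem_hull_sep_map_eq_zero [IsDomain R] [Module.IsTorsionFree R M]
    (hf : ∀ a ∈ A, 0 ≤ f a) (hx : x ∈ PointedCone.hull R A) (hfx : f x = 0) :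
    x ∈ PointedCone.hull R {a ∈ A | f a = 0} := by
  induction hx using Submodule.span_induction with
  | mem a ha => exact PointedCone.subset_hull ⟨ha, hfx⟩
  | zero => exact zero_mem _
  | add y z hy hz ihy ihz =>
    rw [map_add, add_eq_zero_iff_of_nonneg (map_nonneg_of_mem_hull hf hy)
      (map_nonneg_of_mem_hull hf hz)] at hfx
    exact add_mem (ihy hfx.1) (ihz hfx.2)
  | smul c y _ ih =>
    rcases eq_or_ne c 0 with rfl | hc
    · rw [zero_smul]
      exact zero_mem _
    · have hcy : (c : R) • f y = 0 := by rw [← map_smul]; exact hfx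
      have hc' : (c : R) ≠ 0 := fun h => hc (Subtype.ext h)
      exact Submodule.smul_mem _ c (ih ((smul_eq_zero_iff_right hc').1 hcy))

end Hull

section Lex

variable {ι : Type*} [LinearOrder ι]

instance posSMulMono_lex {R : Type*} {M : ι → Type*} [Semiring R] [PartialOrder R]
    [∀ i, AddCommMonoid (M i)] [∀ i, PartialOrder (M i)] [∀ i, Module R (M i)]
    [∀ i, PosSMulStrictMono R (M i)] : PosSMulMono R (Lex (∀ i, M i)) where
  smul_le_smul_of_nonneg_left c hc x y hxy := by
    rcases hc.eq_or_lt with rfl | hc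
    · rw [zero_smul, zero_smul]
    rcases hxy with rfl | ⟨i, heq, hlt⟩
    · exact le_rfl
    · exact .inr ⟨i, fun j hj => congrArg (c • ·) (heq j hj), smul_lt_smul_of_pos_left hlt hc⟩

theorem toLex_nonneg_iff [WellFoundedLT ι] {M : ι → Type*} [∀ i, Zero (M i)]
    [∀ i, LinearOrder (M i)] {x : ∀ i, M i} :
    0 ≤ toLex x ↔ ∀ i, (∀ j < i, x j = 0) → 0 ≤ x i := by
  refine ⟨fun h i hi => Pi.apply_le_of_toLex h fun j hj => (hi j hj).symm, fun h => ?_⟩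
  rw [← not_lt]
  rintro ⟨i, hi, hneg⟩
  exact hneg.not_ge (h i hi)

end Lex

variable {V : Type*} [NormedAddCommGroup V] [InnerProductSpace ℝ V]

theorem exists_inner_eq {A : Set V} (hfin : A.Finite) (hA : LinearIndepOn ℝ id A) (c : V → ℝ) :
    ∃ p : V, ∀ α ∈ A, ⟪α, p⟫ = c α := by
  have := FiniteDimensional.span_of_finite ℝ hfin
  let f : V →ₗ[ℝ] ℝ := (Module.Basis.extend hA).constr ℝ fun i => c i
  let g := LinearMap.toContinuousLinearMap (f ∘ₗ (Submodule.span ℝ A).subtype)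
  refine ⟨((InnerProductSpace.toDual ℝ (Submodule.span ℝ A)).symm g : Submodule.span ℝ A),
    fun α hα => ?_⟩
  have hf : f α = c α := by
    have h := (Module.Basis.extend hA).constr_basis ℝ (fun i => c i) ⟨α, hA.subset_extend _ hα⟩
    rwa [Module.Basis.extend_apply_self] at h
  have hg := InnerProductSpace.toDual_symm_apply (𝕜 := ℝ) (y := g)
    (x := ⟨α, Submodule.subset_span hα⟩)
  rw [real_inner_comm]
  exact hg.trans hf

section Reflections

variable {α : V}

theorem refl_apply_eq (α v : V) : refl α v = v - (2 * ⟪α, v⟫ / ⟪α, α⟫) • α := by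
  rw [refl_apply, inner_smul_right, real_inner_comm α v]
  congr 2
  ring

theorem inner_refl_refl (α x y : V) : ⟪refl α x, refl α y⟫ = ⟪x, y⟫ :=
  (ℝ ∙ α)ᗮ.reflection.inner_map_map x y

theorem refl_refl (α x : V) : refl α (refl α x) = x :=
  (ℝ ∙ α)ᗮ.reflection_reflection x

theorem refl_neg (α : V) : refl (-α) = refl α :=
  LinearEquiv.ext fun x => by simp [refl_apply_eq, neg_div]

theorem refl_self (α : V) : refl α α = -α :=
  Submodule.reflection_orthogonalComplement_singleton_eq_neg α

theorem refl_eq_self_iff (hα : α ≠ 0) {v : V} : refl α v = v ↔ ⟪α, v⟫ = 0 := by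
  rw [refl_apply_eq, sub_eq_self, smul_eq_zero]
  simp [hα]

theorem refl_map {w : V ≃ₗ[ℝ] V} (hw : ∀ x y, ⟪w x, w y⟫ = ⟪x, y⟫) (α : V) :
    refl (w α) = w * refl α * w⁻¹ := by
  rw [eq_mul_inv_iff_mul_eq]
  refine LinearEquiv.ext fun x => ?_
  rw [LinearEquiv.mul_apply, LinearEquiv.mul_apply, refl_apply_eq, refl_apply_eq, hw, hw, map_sub,
    map_smul]

end Reflections

section ReflectionGroup

variable {Φ : Set V} {α : V}

theorem inner_smul_smul (w : reflGroup Φ) (x y : V) : ⟪w • x, w • y⟫ = ⟪x, y⟫ := by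
  obtain ⟨w, hw⟩ := w
  change ⟪w x, w y⟫ = ⟪x, y⟫
  induction hw using Subgroup.closure_induction generalizing x y with
  | mem w hw => obtain ⟨α, -, rfl⟩ := hw; exact inner_refl_refl α x y
  | one => rfl
  | mul _ _ _ _ iha ihb => exact (iha _ _).trans (ihb _ _)
  | inv a _ iha => simpa using (iha (a⁻¹ x) (a⁻¹ y)).symm

instance isIsometricSMul_reflGroup : IsIsometricSMul (reflGroup Φ) V where
  isometry_smul w := ((w : V ≃ₗ[ℝ] V).isometryOfInner (inner_smul_smul w)).isometry

/-- The reflection `s_α` in a root `α`, as an element of the group `W`. -/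
noncomputable def rootRefl (hα : α ∈ Φ) : reflGroup Φ :=
  ⟨refl α, Subgroup.subset_closure ⟨α, hα, rfl⟩⟩

theorem rootRefl_smul (hα : α ∈ Φ) (x : V) : rootRefl hα • x = refl α x := rfl

theorem rootRefl_mul_self (hα : α ∈ Φ) : rootRefl hα * rootRefl hα = 1 :=
  Subtype.ext (LinearEquiv.ext (refl_refl α))

theorem rootRefl_inv (hα : α ∈ Φ) : (rootRefl hα)⁻¹ = rootRefl hα :=
  inv_eq_of_mul_eq_one_left (rootRefl_mul_self hα)

theorem rootRefl_of_eq_smul {β : V} {w : reflGroup Φ} (hα : α ∈ Φ) (hβ : β ∈ Φ) (h : β = w • α) :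
    rootRefl hβ = w * rootRefl hα * w⁻¹ := by
  subst h
  exact Subtype.ext (refl_map (inner_smul_smul w) α)

theorem IsRootSystem.ne_zero (hΦ : IsRootSystem Φ) (hα : α ∈ Φ) : α ≠ 0 :=
  ne_of_mem_of_not_mem hα hΦ.zero_notMem

theorem IsRootSystem.smul_mem (hΦ : IsRootSystem Φ) (w : reflGroup Φ) (hα : α ∈ Φ) :
    w • α ∈ Φ := by
  obtain ⟨w, hw⟩ := w
  change w α ∈ Φ
  induction hw using Subgroup.closure_induction'' generalizing α with
  | mem s hs => obtain ⟨β, hβ, rfl⟩ := hs; exact hΦ.refl_mem β hβ α hα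
  | inv_mem s hs =>
    obtain ⟨β, hβ, rfl⟩ := hs
    exact hΦ.refl_mem β hβ α hα
  | one => exact hα
  | mul _ _ _ _ iha ihb => exact iha (ihb hα)

theorem mem_simpleRootsOf_iff {Δ : Set V} {I : Set (reflGroup Φ)} (hα : α ∈ Φ) :
    α ∈ simpleRootsOf Δ I ↔ α ∈ Δ ∧ rootRefl hα ∈ I := by
  refine and_congr_right fun _ => ⟨?_, fun h => ⟨_, h, rfl⟩⟩
  rintro ⟨s, hs, hsα⟩
  exact (Subtype.ext hsα : s = rootRefl hα) ▸ hs

theorem mem_subRoots_iff {W' : Subgroup (reflGroup Φ)} (hα : α ∈ Φ) :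
    α ∈ subRoots W' ↔ rootRefl hα ∈ W' := by
  refine ⟨?_, fun h => ⟨hα, _, h, rfl⟩⟩
  rintro ⟨-, s, hs, hsα⟩
  exact (Subtype.ext hsα : s = rootRefl hα) ▸ hs

end ReflectionGroup

section LexInner

variable {Φ : Set V} {ι : Type*} {α : V}

/-- The pairing of a vector `x` with a tuple `v`, namely the tuple of all `⟪x, v i⟫`. It takes
values in the lexicographically ordered space, so that `x` is positive on `v` if the first nonzero
`⟪x, v i⟫` is positive. -/
noncomputable def lexInner (v : ι → V) : V →ₗ[ℝ] Lex (ι → ℝ) where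
  toFun x := toLex fun i => ⟪x, v i⟫
  map_add' _ _ := congrArg toLex (funext fun _ => inner_add_left _ _ _)
  map_smul' _ _ := congrArg toLex (funext fun _ => real_inner_smul_left _ _ _)

theorem lexInner_eq_zero_iff {v : ι → V} {x : V} : lexInner v x = 0 ↔ ∀ i, ⟪x, v i⟫ = 0 :=
  funext_iff

theorem lexInner_smul_smul (w : reflGroup Φ) (v : ι → V) (x : V) :
    lexInner (w • v) (w • x) = lexInner v x :=
  congrArg toLex (funext fun i => inner_smul_smul w x (v i))

theorem lexInner_rootRefl_smul (hα : α ∈ Φ) (v : ι → V) (x : V) :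
    lexInner (rootRefl hα • v) x = lexInner v (refl α x) := by
  rw [← lexInner_smul_smul (rootRefl hα), smul_smul, rootRefl_mul_self, one_smul, rootRefl_smul]

theorem IsRootSystem.rootRefl_smul_eq_iff (hΦ : IsRootSystem Φ) (hα : α ∈ Φ) {v : ι → V} :
    rootRefl hα • v = v ↔ lexInner v α = 0 := by
  rw [lexInner_eq_zero_iff, funext_iff]
  exact forall_congr' fun i => refl_eq_self_iff (hΦ.ne_zero hα)

variable [LinearOrder ι]

theorem lexInner_nonneg_iff [WellFoundedLT ι] {v : ι → V} {x : V} :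
    0 ≤ lexInner v x ↔ ∀ i, (∀ j < i, ⟪x, v j⟫ = 0) → 0 ≤ ⟪x, v i⟫ :=
  toLex_nonneg_iff

end LexInner

section SimpleSystem

variable {Φ Δ : Set V} {α γ : V}

theorem IsRootSystem.exists_inner_pos (hΦ : IsRootSystem Φ) (hγ : γ ∈ posRoots Φ Δ) :
    ∃ α ∈ Δ, 0 < ⟪α, γ⟫ := by
  by_contra! hnonpos
  have h : 0 ≤ -⟪γ, γ⟫ :=
    map_nonneg_of_mem_hull (f := -(innerₗ V).flip γ) (fun α hα => neg_nonneg.2 (hnonpos α hα)) hγ.2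
  exact hΦ.ne_zero hγ.1 (real_inner_self_nonpos.1 (neg_nonneg.1 h))

namespace IsSimpleSystem

theorem mem_posRoots (hΔ : IsSimpleSystem Φ Δ) (hα : α ∈ Δ) : α ∈ posRoots Φ Δ :=
  ⟨hΔ.subset hα, PointedCone.subset_hull hα⟩

theorem mem_or_neg_mem (hΔ : IsSimpleSystem Φ Δ) (hα : α ∈ Φ) :
    α ∈ posRoots Φ Δ ∨ -α ∈ posRoots Φ Δ := by
  rwa [← hΔ.union_eq] at hα

theorem neg_notMem (hΔ : IsSimpleSystem Φ Δ) (hα : α ∈ posRoots Φ Δ) : -α ∉ posRoots Φ Δ :=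
  fun h => Set.disjoint_left.1 hΔ.disjoint hα h

theorem finite (hΔ : IsSimpleSystem Φ Δ) (hΦ : IsRootSystem Φ) : Δ.Finite :=
  hΦ.finite.subset hΔ.subset

theorem mem_simpleRefls_iff (hΔ : IsSimpleSystem Φ Δ) {s : reflGroup Φ} :
    s ∈ simpleRefls Φ Δ ↔ ∃ (α : V) (hα : α ∈ Δ), s = rootRefl (hΔ.subset hα) :=
  ⟨fun ⟨α, hα, h⟩ => ⟨α, hα, Subtype.ext h⟩, fun ⟨α, hα, h⟩ => ⟨α, hα, congrArg Subtype.val h⟩⟩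

theorem rootRefl_mem_simpleRefls (hΔ : IsSimpleSystem Φ Δ) (hα : α ∈ Δ) :
    rootRefl (hΔ.subset hα) ∈ simpleRefls Φ Δ :=
  ⟨α, hα, rfl⟩

theorem refl_mem_posRoots (hΔ : IsSimpleSystem Φ Δ) (hΦ : IsRootSystem Φ) (hα : α ∈ Δ)
    (hγ : γ ∈ posRoots Φ Δ) (hne : γ ≠ α) : refl α γ ∈ posRoots Φ Δ := by
  classical
  refine (hΔ.mem_or_neg_mem (hΦ.refl_mem α (hΔ.subset hα) γ hγ.1)).resolve_right
    fun hneg => hne ?_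
  obtain ⟨p, hp⟩ := exists_inner_eq (hΔ.finite hΦ) hΔ.linearIndepOn fun β => if β = α then 0 else 1
  have hpα : ⟪α, p⟫ = 0 := by rw [hp α hα, if_pos rfl]
  have hnonneg : ∀ β ∈ Δ, 0 ≤ (innerₗ V).flip p β := fun β hβ => by
    rw [LinearMap.flip_apply, innerₗ_apply_apply, hp β hβ]
    split_ifs <;> norm_num
  have hzero : ⟪γ, p⟫ = 0 := by
    refine le_antisymm ?_ (map_nonneg_of_mem_hull hnonneg hγ.2)
    have h : 0 ≤ ⟪-refl α γ, p⟫ := map_nonneg_of_mem_hull hnonneg hneg.2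
    rwa [refl_apply_eq, inner_neg_left, inner_sub_left, real_inner_smul_left, hpα, mul_zero,
      sub_zero, neg_nonneg] at h
  have hsub : {β ∈ Δ | (innerₗ V).flip p β = 0} ⊆ {α} := fun β ⟨hβ, hβp⟩ => by
    by_contra hβα
    rw [LinearMap.flip_apply, innerₗ_apply_apply, hp β hβ, if_neg (show β ≠ α from hβα)] at hβp
    exact one_ne_zero hβp
  obtain ⟨c, rfl⟩ := Submodule.mem_span_singleton.1
    (Submodule.span_mono hsub (mem_hull_sep_map_eq_zero hnonneg hγ.2 hzero))
  rcases hΦ.reduced α (hΔ.subset hα) c hγ.1 with hc | hc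
  · exact (congrArg (· • α) hc).trans (one_smul ℝ α)
  · have := c.2
    linarith

theorem exists_smul_mem (hΔ : IsSimpleSystem Φ Δ) (hΦ : IsRootSystem Φ)
    (hγ : γ ∈ posRoots Φ Δ) : ∃ w ∈ parabolic (simpleRefls Φ Δ), w • γ ∈ Δ := by
  -- a root of least height in the orbit of `γ` is simple, as reflections lower the height
  obtain ⟨ρ, hρ⟩ := exists_inner_eq (hΔ.finite hΦ) hΔ.linearIndepOn fun _ => 1
  obtain ⟨_, ⟨hβ, w, hw, rfl⟩, hmin⟩ := Set.exists_min_image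
    {β ∈ posRoots Φ Δ | ∃ w ∈ parabolic (simpleRefls Φ Δ), w • γ = β} (⟪·, ρ⟫)
    (hΦ.finite.subset fun β h => h.1.1) ⟨γ, hγ, 1, one_mem _, one_smul _ γ⟩
  obtain ⟨α, hα, hpos⟩ := hΦ.exists_inner_pos hβ
  refine ⟨w, hw, ?_⟩
  by_contra hwγ
  have hs : refl α (w • γ) ∈ posRoots Φ Δ :=
    hΔ.refl_mem_posRoots hΦ hα hβ (ne_of_mem_of_not_mem hα hwγ).symm
  have h := hmin _ ⟨hs, rootRefl (hΔ.subset hα) * w,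
    mul_mem (Subgroup.subset_closure (hΔ.rootRefl_mem_simpleRefls hα)) hw, mul_smul _ _ _⟩
  have hα0 : 0 < ⟪α, α⟫ := real_inner_self_pos.2 (hΦ.ne_zero (hΔ.subset hα))
  rw [refl_apply_eq, inner_sub_left, real_inner_smul_left, hρ α hα] at h
  have : 0 < 2 * ⟪α, w • γ⟫ / ⟪α, α⟫ := by positivity
  linarith

theorem parabolic_simpleRefls (hΔ : IsSimpleSystem Φ Δ) (hΦ : IsRootSystem Φ) :
    parabolic (simpleRefls Φ Δ) = ⊤ := by
  have hpos : ∀ γ (hγ : γ ∈ posRoots Φ Δ), rootRefl hγ.1 ∈ parabolic (simpleRefls Φ Δ) := by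
    intro γ hγ
    obtain ⟨w, hw, hwγ⟩ := hΔ.exists_smul_mem hΦ hγ
    rw [rootRefl_of_eq_smul (hΔ.subset hwγ) hγ.1 (inv_smul_smul w γ).symm]
    exact mul_mem (mul_mem (inv_mem hw)
      (Subgroup.subset_closure (hΔ.rootRefl_mem_simpleRefls hwγ))) (inv_mem (inv_mem hw))
  have hgen : Subgroup.closure {s : reflGroup Φ | (s : V ≃ₗ[ℝ] V) ∈ refl '' Φ} = ⊤ :=
    Subgroup.closure_closure_coe_preimage
  rw [eq_top_iff, ← hgen, Subgroup.closure_le]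
  rintro s ⟨γ, hγ, hs⟩
  rcases hΔ.mem_or_neg_mem hγ with h | h
  · exact (Subtype.ext hs : rootRefl h.1 = s) ▸ hpos γ h
  · exact (Subtype.ext ((refl_neg γ).trans hs) : rootRefl h.1 = s) ▸ hpos (-γ) h

theorem exists_list_prod_eq (hΔ : IsSimpleSystem Φ Δ) (hΦ : IsRootSystem Φ) (w : reflGroup Φ) :
    ∃ l : List (reflGroup Φ), (∀ s ∈ l, s ∈ simpleRefls Φ Δ) ∧ l.prod = w := by
  have hw : w ∈ parabolic (simpleRefls Φ Δ) := hΔ.parabolic_simpleRefls hΦ ▸ Subgroup.mem_top w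
  rw [parabolic, ← Subgroup.mem_toSubmonoid, Subgroup.closure_toSubmonoid] at hw
  obtain ⟨l, hl, rfl⟩ := Submonoid.exists_list_of_mem_closure hw
  refine ⟨l, fun s hs => (hl s hs).elim id fun h => ?_, rfl⟩
  obtain ⟨α, hα, hsα⟩ := hΔ.mem_simpleRefls_iff.1 h
  rw [inv_eq_iff_eq_inv, rootRefl_inv] at hsα
  exact hsα ▸ hΔ.rootRefl_mem_simpleRefls hα

theorem exists_sublist_prod_mul_rootRefl_eq (hΔ : IsSimpleSystem Φ Δ) (hΦ : IsRootSystem Φ)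
    (hα : α ∈ Δ) {l : List (reflGroup Φ)} (hl : ∀ s ∈ l, s ∈ simpleRefls Φ Δ)
    (hneg : l.prod • α ∉ posRoots Φ Δ) :
    ∃ l' : List (reflGroup Φ), l'.Sublist l ∧ l'.length < l.length ∧
      l.prod * rootRefl (hΔ.subset hα) = l'.prod := by
  induction l with
  | nil => exact absurd (by simpa using hΔ.mem_posRoots hα) hneg
  | cons s l ih =>
    rw [List.forall_mem_cons] at hl
    obtain ⟨β, hβ, rfl⟩ := hΔ.mem_simpleRefls_iff.1 hl.1
    rw [List.prod_cons, mul_smul] at hneg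
    by_cases hlα : l.prod • α ∈ posRoots Φ Δ
    · have heq : β = l.prod • α := by
        by_contra hne
        exact hneg (hΔ.refl_mem_posRoots hΦ hβ hlα (Ne.symm hne))
      refine ⟨l, List.sublist_cons_self _ _, Nat.lt_succ_self _, ?_⟩
      have hconj := rootRefl_of_eq_smul (hΔ.subset hα) (hΔ.subset hβ) heq
      rw [List.prod_cons, mul_assoc, eq_mul_inv_iff_mul_eq.1 hconj |>.symm, ← mul_assoc,
        rootRefl_mul_self, one_mul]
    · obtain ⟨l', hsub, hlen, hprod⟩ := ih hl.2 hlα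
      exact ⟨_ :: l', hsub.cons_cons _, Nat.succ_lt_succ hlen, by
        rw [List.prod_cons, List.prod_cons, mul_assoc, hprod]⟩

end IsSimpleSystem

end SimpleSystem

section LexDominant

variable {Φ Δ : Set V} {ι : Type*} {α γ : V} {v : ι → V} {w : reflGroup Φ}

/-- The simple reflections fixing `v`. -/
def simpleStab (Φ Δ : Set V) (v : ι → V) : Set (reflGroup Φ) := {s ∈ simpleRefls Φ Δ | s • v = v}

theorem mem_simpleRootsOf_simpleStab_iff (hΦ : IsRootSystem Φ) (hΔ : IsSimpleSystem Φ Δ) :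
    α ∈ simpleRootsOf Δ (simpleStab Φ Δ v) ↔ α ∈ Δ ∧ lexInner v α = 0 := by
  refine ⟨fun h => ⟨h.1, ?_⟩, fun ⟨hα, h⟩ => ?_⟩
  · have hα := hΔ.subset h.1
    exact (hΦ.rootRefl_smul_eq_iff hα).1 ((mem_simpleRootsOf_iff hα).1 h).2.2
  · refine (mem_simpleRootsOf_iff (hΔ.subset hα)).2 ⟨hα, hΔ.rootRefl_mem_simpleRefls hα, ?_⟩
    exact (hΦ.rootRefl_smul_eq_iff _).2 h

theorem parabolic_simpleStab_le : parabolic (simpleStab Φ Δ v) ≤ MulAction.stabilizer _ v :=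
  (Subgroup.closure_le _).2 fun _ hs => hs.2

theorem IsRootSystem.mem_subRoots_stabilizer_iff (hΦ : IsRootSystem Φ) :
    α ∈ subRoots (MulAction.stabilizer (reflGroup Φ) v) ↔ α ∈ Φ ∧ lexInner v α = 0 := by
  refine ⟨fun h => ⟨h.1, ?_⟩, fun ⟨hα, h⟩ => ?_⟩
  · exact (hΦ.rootRefl_smul_eq_iff h.1).1 ((mem_subRoots_iff h.1).1 h)
  · exact (mem_subRoots_iff hα).2 ((hΦ.rootRefl_smul_eq_iff hα).2 h)

variable [LinearOrder ι]

/-- `v` is dominant for the lexicographic order: every simple root is nonnegative on `v`. For a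
single vector this is membership in the fundamental chamber. -/
def LexDominant (Δ : Set V) (v : ι → V) : Prop := ∀ α ∈ Δ, 0 ≤ lexInner v α

/-- The positive roots that are negative on `v`; `v` is dominant iff there are none. -/
def negRoots (Φ Δ : Set V) (v : ι → V) : Set V := {β ∈ posRoots Φ Δ | lexInner v β < 0}

theorem ncard_negRoots_rootRefl_smul_lt (hΦ : IsRootSystem Φ) (hΔ : IsSimpleSystem Φ Δ)
    (hα : α ∈ Δ) (hneg : lexInner v α < 0) :
    (negRoots Φ Δ (rootRefl (hΔ.subset hα) • v)).ncard < (negRoots Φ Δ v).ncard := by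
  have hfin : (negRoots Φ Δ v).Finite := hΦ.finite.subset fun β h => h.1.1
  refine lt_of_le_of_lt ?_
    (Set.ncard_sdiff_singleton_lt_of_mem (⟨hΔ.mem_posRoots hα, hneg⟩ : α ∈ negRoots Φ Δ v) hfin)
  refine Set.ncard_le_ncard_of_injOn (refl α) ?_ (refl α).injective.injOn hfin.sdiff
  rintro β ⟨hβ, hβneg⟩
  rw [lexInner_rootRefl_smul] at hβneg
  have hne : β ≠ α := by
    rintro rfl
    rw [refl_self, map_neg, neg_neg_iff_pos] at hβneg
    exact hneg.not_gt hβneg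
  refine ⟨⟨hΔ.refl_mem_posRoots hΦ hα hβ hne, hβneg⟩, fun h => ?_⟩
  have hβα : β = -α := by rw [← refl_refl α β, Set.mem_singleton_iff.1 h, refl_self]
  exact hΔ.neg_notMem (hΔ.mem_posRoots hα) (hβα ▸ hβ)

theorem exists_lexDominant_smul [WellFoundedLT ι] (hΦ : IsRootSystem Φ) (hΔ : IsSimpleSystem Φ Δ)
    (v : ι → V) : ∃ w : reflGroup Φ, LexDominant Δ (w • v) := by
  let f : reflGroup Φ → ℕ := fun w => (negRoots Φ Δ (w • v)).ncard
  refine ⟨Function.argmin f, fun α hα => not_lt.1 fun hneg => ?_⟩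
  have h := ncard_negRoots_rootRefl_smul_lt hΦ hΔ hα hneg
  rw [smul_smul] at h
  exact Function.not_lt_argmin f _ h

theorem LexDominant.nonneg_of_mem_posRoots (hv : LexDominant Δ v) (hγ : γ ∈ posRoots Φ Δ) :
    0 ≤ lexInner v γ :=
  map_nonneg_of_mem_hull hv hγ.2

theorem LexDominant.eq_zero_of_smul_notMem_posRoots (hΦ : IsRootSystem Φ) (hΔ : IsSimpleSystem Φ Δ)
    (hv : LexDominant Δ v) (hwv : LexDominant Δ (w • v)) (hα : α ∈ Δ)
    (hneg : w • α ∉ posRoots Φ Δ) : lexInner v α = 0 := by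
  refine le_antisymm ?_ (hv α hα)
  have hpos := (hΔ.mem_or_neg_mem (hΦ.smul_mem w (hΔ.subset hα))).resolve_left hneg
  have h := hwv.nonneg_of_mem_posRoots hpos
  rwa [map_neg, lexInner_smul_smul, neg_nonneg] at h

theorem LexDominant.smul_eq_and_mem_parabolic (hΦ : IsRootSystem Φ) (hΔ : IsSimpleSystem Φ Δ)
    (hv : LexDominant Δ v) (hwv : LexDominant Δ (w • v)) :
    w • v = v ∧ w ∈ parabolic (simpleStab Φ Δ v) := by
  -- induction on the length of a word for `w`, splitting off its last letter `s_α`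
  obtain ⟨l, hl, rfl⟩ := hΔ.exists_list_prod_eq hΦ w
  induction hn : l.length using Nat.strong_induction_on generalizing l with
  | _ n ih =>
  subst hn
  rcases l.eq_nil_or_concat with rfl | ⟨l, s, rfl⟩
  · exact ⟨one_smul _ v, one_mem _⟩
  have hs := hl s (by simp)
  obtain ⟨α, hα, rfl⟩ := hΔ.mem_simpleRefls_iff.1 hs
  have hl₀ : ∀ t ∈ l, t ∈ simpleRefls Φ Δ := fun t ht => hl t (by simp [ht])
  rw [List.concat_eq_append, List.prod_append, List.prod_singleton] at hwv ⊢
  rw [List.length_concat] at ih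
  by_cases hlα : l.prod • α ∈ posRoots Φ Δ
  · have hα0 : lexInner v α = 0 := by
      refine hv.eq_zero_of_smul_notMem_posRoots hΦ hΔ hwv hα ?_
      rw [mul_smul, rootRefl_smul, refl_self, smul_neg]
      exact hΔ.neg_notMem hlα
    have hfix := (hΦ.rootRefl_smul_eq_iff (hΔ.subset hα)).2 hα0
    rw [mul_smul, hfix] at hwv ⊢
    obtain ⟨heq, hmem⟩ := ih _ (Nat.lt_succ_self _) l hl₀ hwv rfl
    exact ⟨heq, mul_mem hmem (Subgroup.subset_closure ⟨hs, hfix⟩)⟩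
  · obtain ⟨l', hsub, hlen, hprod⟩ := hΔ.exists_sublist_prod_mul_rootRefl_eq hΦ hα hl₀ hlα
    rw [hprod] at hwv ⊢
    exact ih _ (Nat.lt_succ_of_lt hlen) l' (fun t ht => hl₀ t (hsub.subset ht)) hwv rfl

theorem LexDominant.stabilizer_eq (hΦ : IsRootSystem Φ) (hΔ : IsSimpleSystem Φ Δ)
    (hv : LexDominant Δ v) :
    MulAction.stabilizer (reflGroup Φ) v = parabolic (simpleStab Φ Δ v) := by
  refine le_antisymm (fun w hw => ?_) parabolic_simpleStab_le
  have hwv : w • v = v := hw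
  exact (hv.smul_eq_and_mem_parabolic hΦ hΔ (hwv.symm ▸ hv)).2

theorem LexDominant.mem_hull_simpleRootsOf (hΦ : IsRootSystem Φ) (hΔ : IsSimpleSystem Φ Δ)
    (hv : LexDominant Δ v) (hγ : γ ∈ posRoots Φ Δ) (h : lexInner v γ = 0) :
    γ ∈ PointedCone.hull ℝ (simpleRootsOf Δ (simpleStab Φ Δ v)) :=
  Submodule.span_mono (fun _ hα => (mem_simpleRootsOf_simpleStab_iff hΦ hΔ).2 hα)
    (mem_hull_sep_map_eq_zero hv hγ.2 h)

theorem LexDominant.isSimpleSystem_subRoots_stabilizer (hΦ : IsRootSystem Φ)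
    (hΔ : IsSimpleSystem Φ Δ) (hv : LexDominant Δ v) :
    IsSimpleSystem (subRoots (MulAction.stabilizer (reflGroup Φ) v))
      (simpleRootsOf Δ (simpleStab Φ Δ v)) := by
  have hsub : simpleRootsOf Δ (simpleStab Φ Δ v) ⊆ Δ := fun α hα => hα.1
  have hpos : posRoots (subRoots (MulAction.stabilizer (reflGroup Φ) v))
      (simpleRootsOf Δ (simpleStab Φ Δ v)) = {γ ∈ posRoots Φ Δ | lexInner v γ = 0} := by
    refine Set.Subset.antisymm (fun γ hγ => ?_) fun γ ⟨hγ, h⟩ => ?_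
    · have h := hΦ.mem_subRoots_stabilizer_iff.1 hγ.1
      exact ⟨⟨h.1, Submodule.span_mono hsub hγ.2⟩, h.2⟩
    · exact ⟨hΦ.mem_subRoots_stabilizer_iff.2 ⟨hγ.1, h⟩, hv.mem_hull_simpleRootsOf hΦ hΔ hγ h⟩
  refine ⟨fun α hα => ?_, hΔ.linearIndepOn.mono hsub, Set.ext fun γ => ?_, ?_⟩
  · exact hΦ.mem_subRoots_stabilizer_iff.2
      ⟨hΔ.subset hα.1, ((mem_simpleRootsOf_simpleStab_iff hΦ hΔ).1 hα).2⟩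
  · rw [hpos, hΦ.mem_subRoots_stabilizer_iff, ← Set.ext_iff.1 hΔ.union_eq γ]
    simp only [Set.mem_union, Set.mem_neg, Set.mem_ofPred_eq, map_neg, neg_eq_zero, or_and_right]
  · rw [hpos]
    exact hΔ.disjoint.mono (fun γ h => h.1) fun γ h => h.1

theorem LexDominant.mem_chamber_stabilizer_iff (hΦ : IsRootSystem Φ) (hΔ : IsSimpleSystem Φ Δ)
    (hv : LexDominant Δ v) {x : V} :
    x ∈ chamber Δ (MulAction.stabilizer (reflGroup Φ) v) ↔
      ∀ α ∈ Δ, lexInner v α = 0 → 0 ≤ ⟪α, x⟫ := by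
  refine ⟨fun hx α hα h => ?_, ?_⟩
  · rw [real_inner_comm]
    refine hx α ⟨_, ⟨hv.isSimpleSystem_subRoots_stabilizer hΦ hΔ, fun β hβ => ?_⟩, ?_⟩
    · exact hΔ.mem_posRoots hβ.1
    · exact (mem_simpleRootsOf_simpleStab_iff hΦ hΔ).2 ⟨hα, h⟩
  · rintro hx γ ⟨Γ, ⟨hΓ, hΓpos⟩, hγ⟩
    have hγ0 := (hΦ.mem_subRoots_stabilizer_iff.1 (hΓ.subset hγ)).2
    rw [real_inner_comm]
    refine map_nonneg_of_mem_hull (f := (innerₗ V).flip x) (fun α hα => ?_)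
      (hv.mem_hull_simpleRootsOf hΦ hΔ (hΓpos hγ) hγ0)
    exact hx α hα.1 ((mem_simpleRootsOf_simpleStab_iff hΦ hΔ).1 hα).2

end LexDominant

section Truncate

variable {n : ℕ}

section Zero

variable {M G : Type*} [Zero M] [SMulZeroClass G M]

/-- The tuple `(v_1, …, v_k, 0, …, 0)`, which has the same stabiliser as `(v_1, …, v_k)`. -/
def truncate (v : Fin n → M) (k : Fin (n + 1)) : Fin n → M :=
  fun i => if i.castSucc < k then v i else 0

theorem truncate_zero (v : Fin n → M) : truncate v 0 = 0 :=
  funext fun _ => if_neg (Fin.not_lt_zero _)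

theorem truncate_last (v : Fin n → M) : truncate v (Fin.last n) = v :=
  funext fun i => if_pos i.castSucc_lt_last

theorem truncate_smul (w : G) (v : Fin n → M) (k : Fin (n + 1)) :
    truncate (w • v) k = w • truncate v k :=
  funext fun i => by simp only [truncate, Pi.smul_apply, smul_ite, smul_zero]

theorem smul_truncate_eq_iff {w : G} {v : Fin n → M} {k : Fin (n + 1)} :
    w • truncate v k = truncate v k ↔ ∀ i, i.castSucc < k → w • v i = v i := by
  rw [funext_iff]
  refine forall_congr' fun i => ?_
  by_cases hi : i.castSucc < k <;> simp [truncate, hi]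

end Zero

variable {Φ Δ : Set V} {v : Fin n → V} {x : V}

theorem truncStab_eq_stabilizer (m : Fin n) :
    truncStab Φ v m = MulAction.stabilizer (reflGroup Φ) (truncate v m.castSucc) := by
  ext w
  rw [MulAction.mem_stabilizer_iff, smul_truncate_eq_iff]
  simp [truncStab, Subgroup.mem_iInf]

theorem lexInner_truncate_eq_zero_iff {k : Fin (n + 1)} :
    lexInner (truncate v k) x = 0 ↔ ∀ i, i.castSucc < k → ⟪x, v i⟫ = 0 := by
  rw [lexInner_eq_zero_iff]
  refine forall_congr' fun i => ?_
  by_cases hi : i.castSucc < k <;> simp [truncate, hi]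

theorem lexInner_truncate_succ_eq_zero_iff {i : Fin n} :
    lexInner (truncate v i.succ) x = 0 ↔
      lexInner (truncate v i.castSucc) x = 0 ∧ ⟪x, v i⟫ = 0 := by
  simp only [lexInner_truncate_eq_zero_iff, Fin.castSucc_lt_succ_iff, Fin.castSucc_lt_castSucc_iff,
    le_iff_lt_or_eq (α := Fin n), or_imp, forall_and, forall_eq]

theorem lexInner_truncate_nonneg_iff {k : Fin (n + 1)} :
    0 ≤ lexInner (truncate v k) x ↔
      ∀ i, i.castSucc < k → lexInner (truncate v i.castSucc) x = 0 → 0 ≤ ⟪x, v i⟫ := by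
  rw [lexInner_nonneg_iff]
  refine forall_congr' fun i => ?_
  by_cases hi : i.castSucc < k
  · have heq : ∀ j ≤ i, truncate v k j = v j := fun j hj =>
      if_pos ((Fin.castSucc_le_castSucc_iff.2 hj).trans_lt hi)
    rw [heq i le_rfl, lexInner_truncate_eq_zero_iff]
    simp +contextual only [hi, heq _ (le_of_lt _), Fin.castSucc_lt_castSucc_iff, true_imp_iff]
  · simp [truncate, hi]

theorem lexInner_truncate_succ_nonneg_iff {i : Fin n} :
    0 ≤ lexInner (truncate v i.succ) x ↔ 0 ≤ lexInner (truncate v i.castSucc) x ∧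
      (lexInner (truncate v i.castSucc) x = 0 → 0 ≤ ⟪x, v i⟫) := by
  simp only [lexInner_truncate_nonneg_iff, Fin.castSucc_lt_succ_iff, Fin.castSucc_lt_castSucc_iff,
    le_iff_lt_or_eq (α := Fin n), or_imp, forall_and, forall_eq]

theorem lexDominant_truncate_zero : LexDominant Δ (truncate v 0) := fun α _ => by
  rw [lexInner_truncate_nonneg_iff]
  exact fun i hi => absurd hi (Fin.not_lt_zero _)

theorem lexDominant_truncate_succ_iff {i : Fin n} :
    LexDominant Δ (truncate v i.succ) ↔ LexDominant Δ (truncate v i.castSucc) ∧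
      ∀ α ∈ Δ, lexInner (truncate v i.castSucc) α = 0 → 0 ≤ ⟪α, v i⟫ := by
  simp only [LexDominant, lexInner_truncate_succ_nonneg_iff, forall_and]

theorem lexDominant_truncate (hv : LexDominant Δ v) (k : Fin (n + 1)) :
    LexDominant Δ (truncate v k) := by
  induction k using Fin.reverseInduction with
  | last => rwa [truncate_last]
  | cast i ih => exact (lexDominant_truncate_succ_iff.1 ih).1

theorem mem_fundRegion_iff (hΦ : IsRootSystem Φ) (hΔ : IsSimpleSystem Φ Δ) :
    v ∈ fundRegion Φ Δ n ↔ LexDominant Δ v := by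
  have hstep : ∀ i : Fin n, LexDominant Δ (truncate v i.castSucc) →
      (v i ∈ chamber Δ (truncStab Φ v i) ↔
        LexDominant Δ (truncate v i.succ)) := fun i hi => by
    rw [truncStab_eq_stabilizer, hi.mem_chamber_stabilizer_iff hΦ hΔ, lexDominant_truncate_succ_iff,
      and_iff_right hi]
  refine ⟨fun hv => ?_, fun hv i =>
    (hstep i (lexDominant_truncate hv _)).2 (lexDominant_truncate hv _)⟩
  have hall : ∀ k, LexDominant Δ (truncate v k) :=
    Fin.induction lexDominant_truncate_zero fun i hi => (hstep i hi).1 (hv i)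
  exact truncate_last v ▸ hall (Fin.last n)

end Truncate

section Cells

variable {Φ Δ : Set V} {n : ℕ} {v : Fin n → V} {I J : Fin (n + 1) → Set (reflGroup Φ)}

theorem simpleRootsOf_mono {I J : Set (reflGroup Φ)} (hJI : J ⊆ I) :
    simpleRootsOf Δ J ⊆ simpleRootsOf Δ I :=
  fun _ ⟨hα, s, hs, hsα⟩ => ⟨hα, s, hJI hs, hsα⟩

theorem IsSimpleSystem.simpleRootsOf_diff (hΔ : IsSimpleSystem Φ Δ) (I J : Set (reflGroup Φ)) :
    simpleRootsOf Δ (I \ J) = simpleRootsOf Δ I \ simpleRootsOf Δ J := by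
  ext α
  by_cases hα : α ∈ Δ
  · simp only [Set.mem_sdiff, mem_simpleRootsOf_iff (hΔ.subset hα), hα, true_and]
  · exact iff_of_false (fun h => hα h.1) fun h => hα h.1.1

theorem IsSimpleSystem.simpleRootsOf_injOn (hΔ : IsSimpleSystem Φ Δ) :
    Set.InjOn (simpleRootsOf Δ) (𝒫 simpleRefls Φ Δ) := by
  have hsub : ∀ I ∈ 𝒫 simpleRefls Φ Δ, ∀ J, simpleRootsOf Δ I ⊆ simpleRootsOf Δ J → I ⊆ J := by
    intro I hI J hIJ s hs
    obtain ⟨α, hα, rfl⟩ := hΔ.mem_simpleRefls_iff.1 (hI hs)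
    exact ((mem_simpleRootsOf_iff (hΔ.subset hα)).1 (hIJ ⟨hα, _, hs, rfl⟩)).2
  exact fun I hI J hJ h => (hsub I hI J h.subset).antisymm (hsub J hJ I h.superset)

theorem IsSimpleSystem.mem_facet_iff (hΔ : IsSimpleSystem Φ Δ) {I J : Set (reflGroup Φ)}
    (hJI : J ⊆ I) {x : V} :
    x ∈ facet Δ I J ↔ (∀ α ∈ simpleRootsOf Δ I, 0 ≤ ⟪α, x⟫) ∧
      simpleRootsOf Δ J = {α ∈ simpleRootsOf Δ I | ⟪α, x⟫ = 0} := by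
  simp only [facet, hΔ.simpleRootsOf_diff, Set.mem_ofPred_eq, Set.ext_iff, Set.mem_sdiff]
  constructor
  · rintro ⟨h0, hpos⟩
    refine ⟨fun α hα => ?_, fun α =>
      ⟨fun h => ⟨simpleRootsOf_mono hJI h, h0 α h⟩, fun ⟨hα, h⟩ => ?_⟩⟩
    · by_cases hαJ : α ∈ simpleRootsOf Δ J
      exacts [(h0 α hαJ).ge, (hpos α ⟨hα, hαJ⟩).le]
    · by_contra hαJ
      exact (hpos α ⟨hα, hαJ⟩).ne' h
  · rintro ⟨hnonneg, hJ⟩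
    exact ⟨fun α hα => ((hJ α).1 hα).2, fun α ⟨hα, hαJ⟩ =>
      (hnonneg α hα).lt_of_ne' fun h => hαJ ((hJ α).2 ⟨hα, h⟩)⟩

theorem chains_subset_simpleRefls (hI : I ∈ chains Φ Δ n) (k : Fin (n + 1)) :
    I k ⊆ simpleRefls Φ Δ :=
  hI.1 ▸ hI.2 (Fin.zero_le k)

/-- The sequence of the sets of simple reflections fixing `(v_1, …, v_k)`. A dominant `v` lies in
the cell of this sequence, and in no other. -/
def stabFlag (Φ Δ : Set V) (v : Fin n → V) (k : Fin (n + 1)) : Set (reflGroup Φ) :=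
  simpleStab Φ Δ (truncate v k)

theorem stabFlag_mem_chains : stabFlag Φ Δ v ∈ chains Φ Δ n := by
  refine ⟨Set.ext fun s => and_iff_left ?_, fun k l hkl s ⟨hs, hsv⟩ => ⟨hs, ?_⟩⟩
  · rw [truncate_zero, smul_zero]
  · rw [smul_truncate_eq_iff] at hsv ⊢
    exact fun i hi => hsv i (hi.trans_le hkl)

theorem mem_simpleRootsOf_stabFlag_iff (hΦ : IsRootSystem Φ) (hΔ : IsSimpleSystem Φ Δ)
    {k : Fin (n + 1)} {α : V} :
    α ∈ simpleRootsOf Δ (stabFlag Φ Δ v k) ↔ α ∈ Δ ∧ lexInner (truncate v k) α = 0 :=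
  mem_simpleRootsOf_simpleStab_iff hΦ hΔ

theorem mem_facet_stabFlag_iff (hΦ : IsRootSystem Φ) (hΔ : IsSimpleSystem Φ Δ) {i : Fin n}
    (hI : I ∈ chains Φ Δ n) (hv : LexDominant Δ (truncate v i.castSucc))
    (hIi : I i.castSucc = stabFlag Φ Δ v i.castSucc) :
    v i ∈ facet Δ (I i.castSucc) (I i.succ) ↔
      I i.succ = stabFlag Φ Δ v i.succ ∧ LexDominant Δ (truncate v i.succ) := by
  have hroots : simpleRootsOf Δ (stabFlag Φ Δ v i.succ) =
      {α ∈ simpleRootsOf Δ (stabFlag Φ Δ v i.castSucc) | ⟪α, v i⟫ = 0} := by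
    ext α
    simp only [Set.mem_ofPred_eq, mem_simpleRootsOf_stabFlag_iff hΦ hΔ,
      lexInner_truncate_succ_eq_zero_iff, and_assoc]
  rw [hΔ.mem_facet_iff (hI.2 i.castSucc_le_succ), hIi, ← hroots, hΔ.simpleRootsOf_injOn.eq_iff
    (chains_subset_simpleRefls hI _) (chains_subset_simpleRefls stabFlag_mem_chains _), and_comm,
    lexDominant_truncate_succ_iff, and_iff_right hv]
  simp only [mem_simpleRootsOf_stabFlag_iff hΦ hΔ, and_imp]

theorem mem_cell_iff (hΦ : IsRootSystem Φ) (hΔ : IsSimpleSystem Φ Δ) (hI : I ∈ chains Φ Δ n) :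
    v ∈ cell Δ I ↔ I = stabFlag Φ Δ v ∧ LexDominant Δ v := by
  constructor
  · intro hv
    have h : ∀ k, I k = stabFlag Φ Δ v k ∧ LexDominant Δ (truncate v k) :=
      Fin.induction ⟨hI.1.trans stabFlag_mem_chains.1.symm, lexDominant_truncate_zero⟩
        fun i ⟨hIi, hvi⟩ => (mem_facet_stabFlag_iff hΦ hΔ hI hvi hIi).1 (hv i trivial)
    exact ⟨funext fun k => (h k).1, truncate_last v ▸ (h (Fin.last n)).2⟩
  · rintro ⟨rfl, hv⟩ i -
    exact (mem_facet_stabFlag_iff hΦ hΔ hI (lexDominant_truncate hv _) rfl).2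
      ⟨rfl, lexDominant_truncate hv _⟩

theorem stabFlag_last : stabFlag Φ Δ v (Fin.last n) = simpleStab Φ Δ v :=
  congrArg (simpleStab Φ Δ) (truncate_last v)

theorem cell_subset_fundRegion (hΦ : IsRootSystem Φ) (hΔ : IsSimpleSystem Φ Δ)
    (hI : I ∈ chains Φ Δ n) : cell Δ I ⊆ fundRegion Φ Δ n :=
  fun _ hv => (mem_fundRegion_iff hΦ hΔ).2 ((mem_cell_iff hΦ hΔ hI).1 hv).2

theorem stabilizer_of_mem_cell (hΦ : IsRootSystem Φ) (hΔ : IsSimpleSystem Φ Δ)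
    (hI : I ∈ chains Φ Δ n) (hv : v ∈ cell Δ I) :
    MulAction.stabilizer (reflGroup Φ) v = parabolic (I (Fin.last n)) := by
  obtain ⟨rfl, hdom⟩ := (mem_cell_iff hΦ hΔ hI).1 hv
  rw [stabFlag_last, hdom.stabilizer_eq hΦ hΔ]

theorem eq_and_mem_parabolic_of_smul_mem_cell (hΦ : IsRootSystem Φ) (hΔ : IsSimpleSystem Φ Δ)
    (hI : I ∈ chains Φ Δ n) (hJ : J ∈ chains Φ Δ n) {w : reflGroup Φ} (hv : v ∈ cell Δ J)
    (hwv : w • v ∈ cell Δ I) : I = J ∧ w ∈ parabolic (I (Fin.last n)) := by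
  obtain ⟨hIv, hdom⟩ := (mem_cell_iff hΦ hΔ hI).1 hwv
  obtain ⟨hJv, hdom'⟩ := (mem_cell_iff hΦ hΔ hJ).1 hv
  obtain ⟨hfix, hmem⟩ := hdom'.smul_eq_and_mem_parabolic hΦ hΔ hdom
  rw [hfix, ← hJv] at hIv
  rw [hIv, hJv, stabFlag_last]
  exact ⟨rfl, hmem⟩

theorem cell_nonempty (hΦ : IsRootSystem Φ) (hΔ : IsSimpleSystem Φ Δ)
    (I : Fin (n + 1) → Set (reflGroup Φ)) : (cell Δ I).Nonempty := by
  classical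
  refine Set.univ_pi_nonempty_iff.2 fun i => ?_
  obtain ⟨p, hp⟩ := exists_inner_eq (hΔ.finite hΦ) hΔ.linearIndepOn
    fun α => if α ∈ simpleRootsOf Δ (I i.succ) then 0 else 1
  refine ⟨p, fun α hα => by rw [hp α hα.1, if_pos hα], fun α hα => ?_⟩
  rw [hΔ.simpleRootsOf_diff] at hα
  rw [hp α hα.1.1, if_neg hα.2]
  exact one_pos

theorem stabilizer_cell (hΦ : IsRootSystem Φ) (hΔ : IsSimpleSystem Φ Δ) (hI : I ∈ chains Φ Δ n) :
    MulAction.stabilizer (reflGroup Φ) (cell Δ I) = parabolic (I (Fin.last n)) := by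
  ext w
  refine ⟨fun hw => ?_, fun hw => ?_⟩
  · obtain ⟨v, hv⟩ := cell_nonempty hΦ hΔ I
    exact (eq_and_mem_parabolic_of_smul_mem_cell hΦ hΔ hI hI hv
      (hw ▸ Set.smul_mem_smul_set hv : w • v ∈ cell Δ I)).2
  · have hfix : ∀ v ∈ cell Δ I, w • v = v := fun v hv =>
      (stabilizer_of_mem_cell hΦ hΔ hI hv).ge hw
    exact (Set.image_congr hfix).trans (Set.image_id _)

theorem stabilizer_of_mem_smul_cell (hΦ : IsRootSystem Φ) (hΔ : IsSimpleSystem Φ Δ)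
    (hI : I ∈ chains Φ Δ n) {w : reflGroup Φ} (hv : v ∈ w • cell Δ I) :
    MulAction.stabilizer (reflGroup Φ) v =
      (parabolic (I (Fin.last n))).map (MulAut.conj w).toMonoidHom := by
  obtain ⟨x, hx, rfl⟩ := hv
  rw [← stabilizer_of_mem_cell hΦ hΔ hI hx]
  exact MulAction.stabilizer_smul_eq_stabilizer_map_conj w x

theorem stabilizer_smul_cell (hΦ : IsRootSystem Φ) (hΔ : IsSimpleSystem Φ Δ)
    (hI : I ∈ chains Φ Δ n) (w : reflGroup Φ) :
    MulAction.stabilizer (reflGroup Φ) (w • cell Δ I) =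
      (parabolic (I (Fin.last n))).map (MulAut.conj w).toMonoidHom := by
  rw [← stabilizer_cell hΦ hΔ hI]
  exact MulAction.stabilizer_smul_eq_stabilizer_map_conj w (cell Δ I)

theorem smul_cell_tfae (hΦ : IsRootSystem Φ) (hΔ : IsSimpleSystem Φ Δ) (v w : reflGroup Φ)
    (hI : I ∈ chains Φ Δ n) (hJ : J ∈ chains Φ Δ n) :
    List.TFAE [v • cell Δ I ∩ w • cell Δ J ≠ ∅, v • cell Δ I = w • cell Δ J,
      I = J ∧ v⁻¹ * w ∈ parabolic (I (Fin.last n))] := by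
  tfae_have 1 → 3 := fun h => by
    obtain ⟨x, hxI, hxJ⟩ := Set.nonempty_iff_ne_empty.2 h
    rw [Set.mem_smul_set_iff_inv_smul_mem] at hxI hxJ
    refine eq_and_mem_parabolic_of_smul_mem_cell hΦ hΔ hI hJ hxJ ?_
    rwa [smul_smul, mul_inv_cancel_right]
  tfae_have 3 → 2 := by
    rintro ⟨rfl, h⟩
    rw [← stabilizer_cell hΦ hΔ hI, MulAction.mem_stabilizer_iff, mul_smul, inv_smul_eq_iff] at h
    exact h.symm
  tfae_have 2 → 1 := fun h => by
    rw [← h, Set.inter_self]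
    exact ((cell_nonempty hΦ hΔ I).smul_set).ne_empty
  tfae_finish

theorem strata_pairwiseDisjoint (hΦ : IsRootSystem Φ) (hΔ : IsSimpleSystem Φ Δ) :
    (strata Φ Δ n).PairwiseDisjoint id := by
  rintro _ ⟨v, I, hI, rfl⟩ _ ⟨w, J, hJ, rfl⟩ hne
  rw [Function.onFun, id, id, Set.disjoint_iff_inter_eq_empty]
  by_contra h
  exact hne (((smul_cell_tfae hΦ hΔ v w hI hJ).out 0 1).1 h)

theorem exists_mem_strata (hΦ : IsRootSystem Φ) (hΔ : IsSimpleSystem Φ Δ) (v : Fin n → V) :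
    ∃ F ∈ strata Φ Δ n, v ∈ F := by
  obtain ⟨w, hw⟩ := exists_lexDominant_smul hΦ hΔ v
  exact ⟨_, ⟨w⁻¹, _, stabFlag_mem_chains, rfl⟩, Set.mem_inv_smul_set_iff.2
    ((mem_cell_iff hΦ hΔ stabFlag_mem_chains).2 ⟨rfl, hw⟩)⟩

theorem cell_mem_strata (hI : I ∈ chains Φ Δ n) : cell Δ I ∈ strata Φ Δ n :=
  ⟨1, I, hI, (one_smul _ _).symm⟩

theorem isDisjointUnionOfStrata_fundRegion (hΦ : IsRootSystem Φ) (hΔ : IsSimpleSystem Φ Δ) :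
    IsDisjointUnionOfStrata Φ Δ (fundRegion Φ Δ n) := by
  refine ⟨Set.Subset.antisymm (Set.sUnion_subset fun F hF => hF.2) fun v hv => ?_,
    (strata_pairwiseDisjoint hΦ hΔ).subset fun F hF => hF.1⟩
  have hI := stabFlag_mem_chains (Φ := Φ) (Δ := Δ) (v := v)
  exact ⟨_, ⟨cell_mem_strata hI, cell_subset_fundRegion hΦ hΔ hI⟩,
    (mem_cell_iff hΦ hΔ hI).2 ⟨rfl, (mem_fundRegion_iff hΦ hΔ).1 hv⟩⟩

theorem isDisjointUnionOfStrata_univ (hΦ : IsRootSystem Φ) (hΔ : IsSimpleSystem Φ Δ) :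
    IsDisjointUnionOfStrata Φ Δ (Set.univ : Set (Fin n → V)) := by
  refine ⟨Set.eq_univ_of_forall fun v => ?_,
    (strata_pairwiseDisjoint hΦ hΔ).subset fun F hF => hF.1⟩
  obtain ⟨F, hF, hv⟩ := exists_mem_strata hΦ hΔ v
  exact ⟨F, ⟨hF, F.subset_univ⟩, hv⟩

end Cells

section Closure

variable {Φ Δ : Set V} {n : ℕ} {v : Fin n → V} {I J : Fin (n + 1) → Set (reflGroup Φ)}

theorem IsSimpleSystem.mem_closure_facet_iff (hΔ : IsSimpleSystem Φ Δ) {I J : Set (reflGroup Φ)}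
    (hJI : J ⊆ I) (hne : (facet Δ I J).Nonempty) {x : V} :
    x ∈ closure (facet Δ I J) ↔
      (∀ α ∈ simpleRootsOf Δ J, ⟪α, x⟫ = 0) ∧ ∀ α ∈ simpleRootsOf Δ I, 0 ≤ ⟪α, x⟫ := by
  constructor
  · have hsub : facet Δ I J ⊆ {x : V | (∀ α ∈ simpleRootsOf Δ J, ⟪α, x⟫ = 0) ∧
        ∀ α ∈ simpleRootsOf Δ I, 0 ≤ ⟪α, x⟫} :=
      fun y hy => ⟨hy.1, ((hΔ.mem_facet_iff hJI).1 hy).1⟩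
    refine fun hx => closure_minimal hsub ?_ hx
    simp only [Set.ofPred_and, Set.ofPred_forall]
    refine .inter (isClosed_biInter fun α _ => ?_) (isClosed_biInter fun α _ => ?_)
    · exact isClosed_eq (by fun_prop) continuous_const
    · exact isClosed_le continuous_const (by fun_prop)
  · rintro ⟨h0, hnonneg⟩
    obtain ⟨p, hp0, hp⟩ := hne
    have hcont : ContinuousWithinAt (fun t : ℝ => x + t • p) (Set.Ioi 0) 0 := by fun_prop
    have hmaps : Set.MapsTo (fun t : ℝ => x + t • p) (Set.Ioi 0) (facet Δ I J) := by
      refine fun t ht => ⟨fun α hα => ?_, fun α hα => ?_⟩ <;>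
        rw [inner_add_right, real_inner_smul_right]
      · rw [h0 α hα, hp0 α hα, mul_zero, add_zero]
      · exact add_pos_of_nonneg_of_pos (hnonneg α (simpleRootsOf_mono Set.sdiff_subset hα))
          (mul_pos ht (hp α hα))
    have h := hcont.mem_closure (by simp) hmaps
    rwa [zero_smul, add_zero] at h

theorem mem_closure_cell_iff (hΦ : IsRootSystem Φ) (hΔ : IsSimpleSystem Φ Δ)
    (hI : I ∈ chains Φ Δ n) :
    v ∈ closure (cell Δ I) ↔
      (∀ k, ∀ α ∈ simpleRootsOf Δ (I k), lexInner (truncate v k) α = 0) ∧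
        ∀ i : Fin n, ∀ α ∈ simpleRootsOf Δ (I i.castSucc), 0 ≤ lexInner (truncate v i.succ) α := by
  have hfacet : ∀ i : Fin n, (facet Δ (I i.castSucc) (I i.succ)).Nonempty :=
    Set.univ_pi_nonempty_iff.1 (cell_nonempty hΦ hΔ I)
  simp only [cell, closure_pi_set, Set.mem_univ_pi,
    fun i => hΔ.mem_closure_facet_iff (hI.2 (Fin.castSucc_le_succ i)) (hfacet i)]
  constructor
  · intro h
    have hzero : ∀ k, ∀ α ∈ simpleRootsOf Δ (I k), lexInner (truncate v k) α = 0 := by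
      refine fun k α hα => lexInner_truncate_eq_zero_iff.2 fun i hi => (h i).1 α ?_
      exact simpleRootsOf_mono (hI.2 (Fin.castSucc_lt_iff_succ_le.1 hi)) hα
    exact ⟨hzero, fun i α hα => lexInner_truncate_succ_nonneg_iff.2
      ⟨(hzero _ α hα).ge, fun _ => (h i).2 α hα⟩⟩
  · rintro ⟨hzero, hnonneg⟩ i
    exact ⟨fun α hα => (lexInner_truncate_succ_eq_zero_iff.1 (hzero _ α hα)).2,
      fun α hα => (lexInner_truncate_succ_nonneg_iff.1 (hnonneg i α hα)).2 (hzero _ α hα)⟩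

theorem lexInner_truncate_nonneg_of_mem_cell (hΦ : IsRootSystem Φ) (hΔ : IsSimpleSystem Φ Δ)
    (hI : I ∈ chains Φ Δ n) {v w : Fin n → V} (hv : v ∈ cell Δ I) (hw : w ∈ cell Δ I)
    (k : Fin (n + 1)) {γ : V} (hγ : γ ∈ Φ) (h : 0 ≤ lexInner (truncate v k) γ) :
    0 ≤ lexInner (truncate w k) γ := by
  obtain ⟨hIv, hv⟩ := (mem_cell_iff hΦ hΔ hI).1 hv
  obtain ⟨hIw, hw⟩ := (mem_cell_iff hΦ hΔ hI).1 hw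
  have hv := lexDominant_truncate hv k
  rcases hΔ.mem_or_neg_mem hγ with hpos | hneg
  · exact (lexDominant_truncate hw k).nonneg_of_mem_posRoots hpos
  · -- `-γ` vanishes on `truncate v k`, so lies in the span of the simple roots that do
    have hγ0 : lexInner (truncate v k) (-γ) = 0 := by
      refine le_antisymm ?_ (hv.nonneg_of_mem_posRoots hneg)
      rwa [map_neg, neg_nonpos]
    have hhull : -γ ∈ PointedCone.hull ℝ (simpleRootsOf Δ (stabFlag Φ Δ w k)) :=
      (hIv.symm.trans hIw) ▸ hv.mem_hull_simpleRootsOf hΦ hΔ hneg hγ0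
    have hnonneg := map_nonneg_of_mem_hull (f := -lexInner (truncate w k)) (fun α hα => by
      rw [LinearMap.neg_apply, ((mem_simpleRootsOf_stabFlag_iff hΦ hΔ).1 hα).2, neg_zero]) hhull
    rwa [LinearMap.neg_apply, map_neg, neg_neg] at hnonneg

theorem lexInner_truncate_eq_zero_of_mem_cell (hΦ : IsRootSystem Φ) (hΔ : IsSimpleSystem Φ Δ)
    (hI : I ∈ chains Φ Δ n) {v w : Fin n → V} (hv : v ∈ cell Δ I) (hw : w ∈ cell Δ I)
    (k : Fin (n + 1)) {γ : V} (hγ : γ ∈ Φ) (h : lexInner (truncate v k) γ = 0) :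
    lexInner (truncate w k) γ = 0 := by
  have hle : ∀ δ ∈ Φ, lexInner (truncate v k) δ = 0 → 0 ≤ lexInner (truncate w k) δ :=
    fun δ hδ h => lexInner_truncate_nonneg_of_mem_cell hΦ hΔ hI hv hw k hδ h.ge
  have hneg : -γ ∈ Φ := refl_self γ ▸ hΦ.refl_mem γ hγ γ hγ
  have h' := hle (-γ) hneg (by rw [map_neg, h, neg_zero])
  rw [map_neg, neg_nonneg] at h'
  exact le_antisymm h' (hle γ hγ h)

theorem smul_cell_subset_closure_cell (hΦ : IsRootSystem Φ) (hΔ : IsSimpleSystem Φ Δ)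
    (hI : I ∈ chains Φ Δ n) (hJ : J ∈ chains Φ Δ n) {w : reflGroup Φ} (hv : v ∈ w • cell Δ J)
    (hvI : v ∈ closure (cell Δ I)) : w • cell Δ J ⊆ closure (cell Δ I) := by
  obtain ⟨v, hv, rfl⟩ := hv
  rintro _ ⟨x, hx, rfl⟩
  have hsmul : ∀ (y : Fin n → V) (k : Fin (n + 1)) (α : V),
      lexInner (truncate (w • y) k) α = lexInner (truncate y k) (w⁻¹ • α) := fun y k α => by
    rw [truncate_smul, ← lexInner_smul_smul w _ (w⁻¹ • α), smul_inv_smul]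
  have hroot : ∀ k, ∀ α ∈ simpleRootsOf Δ (I k), w⁻¹ • α ∈ Φ := fun k α hα =>
    hΦ.smul_mem _ (hΔ.subset hα.1)
  simp only [mem_closure_cell_iff hΦ hΔ hI, hsmul] at hvI ⊢
  exact ⟨fun k α hα => lexInner_truncate_eq_zero_of_mem_cell hΦ hΔ hJ hv hx k
      (hroot k α hα) (hvI.1 k α hα),
    fun i α hα => lexInner_truncate_nonneg_of_mem_cell hΦ hΔ hJ hv hx i.succ
      (hroot _ α hα) (hvI.2 i α hα)⟩

theorem closure_eq_sUnion_strata (hΦ : IsRootSystem Φ) (hΔ : IsSimpleSystem Φ Δ)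
    {F : Set (Fin n → V)} (hF : F ∈ strata Φ Δ n) :
    closure F = ⋃₀ {G ∈ strata Φ Δ n | G ⊆ closure F} := by
  refine Set.Subset.antisymm (fun v hv => ?_) (Set.sUnion_subset fun G hG => hG.2)
  obtain ⟨u, I, hI, rfl⟩ := hF
  obtain ⟨_, ⟨w, J, hJ, rfl⟩, hvG⟩ := exists_mem_strata hΦ hΔ v
  refine ⟨_, ⟨⟨w, J, hJ, rfl⟩, ?_⟩, hvG⟩
  rw [closure_smul, Set.subset_smul_set_iff, smul_smul]
  rw [closure_smul, Set.mem_smul_set_iff_inv_smul_mem] at hv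
  refine smul_cell_subset_closure_cell hΦ hΔ hI hJ ?_ hv
  rw [mul_smul]
  exact Set.smul_mem_smul_set hvG

end Closure

end DiagonalStrata

open DiagonalStrata in
theorem theorem3p1_general {V : Type*} [NormedAddCommGroup V] [InnerProductSpace ℝ V]
    (Φ Δ : Set V) (hΦ : IsRootSystem Φ) (hΔ : IsSimpleSystem Φ Δ) (n : ℕ) :
    (∀ I ∈ chains Φ Δ n, cell Δ I ⊆ fundRegion Φ Δ n) ∧
    (∀ I ∈ chains Φ Δ n, ∀ w : reflGroup Φ, ∀ v ∈ w • cell Δ I,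
        MulAction.stabilizer (reflGroup Φ) v =
          (parabolic (I (Fin.last n))).map (MulAut.conj w).toMonoidHom) ∧
    (∀ v w : reflGroup Φ, ∀ I ∈ chains Φ Δ n, ∀ J ∈ chains Φ Δ n,
        List.TFAE [
          v • cell Δ I ∩ w • cell Δ J ≠ ∅,
          v • cell Δ I = w • cell Δ J,
          I = J ∧ v⁻¹ * w ∈ parabolic (I (Fin.last n))]) ∧
    (∀ I ∈ chains Φ Δ n, ∀ w : reflGroup Φ,
      MulAction.stabilizer (reflGroup Φ) (w • cell Δ I) =
        (parabolic (I (Fin.last n))).map (MulAut.conj w).toMonoidHom) ∧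
    (IsDisjointUnionOfStrata Φ Δ (fundRegion Φ Δ n) ∧
      IsDisjointUnionOfStrata Φ Δ (Set.univ : Set (Fin n → V))) ∧
    (∀ F ∈ strata Φ Δ n, ∃ 𝒢 ⊆ strata Φ Δ n, closure F = ⋃₀ 𝒢) :=
  ⟨fun _ hI => cell_subset_fundRegion hΦ hΔ hI,
    fun _ hI _ _ hv => stabilizer_of_mem_smul_cell hΦ hΔ hI hv,
    fun v w _ hI _ hJ => smul_cell_tfae hΦ hΔ v w hI hJ,
    fun _ hI w => stabilizer_smul_cell hΦ hΔ hI w,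
    ⟨isDisjointUnionOfStrata_fundRegion hΦ hΔ, isDisjointUnionOfStrata_univ hΦ hΔ⟩,
    fun _ hF => ⟨_, Set.sep_subset _ _, closure_eq_sUnion_strata hΦ hΔ hF⟩⟩

theorem theorem3p1 {V : Type*} [NormedAddCommGroup V] [InnerProductSpace ℝ V]
    [FiniteDimensional ℝ V] (Φ Δ : Set V) (hΦ : DiagonalStrata.IsRootSystem Φ)
    (hΔ : DiagonalStrata.IsSimpleSystem Φ Δ) (n : ℕ) (hn : 1 ≤ n) :
    -- (a)
    (∀ I ∈ DiagonalStrata.chains Φ Δ n,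
      DiagonalStrata.cell Δ I ⊆ DiagonalStrata.fundRegion Φ Δ n) ∧
    -- (b)
    (∀ I ∈ DiagonalStrata.chains Φ Δ n, ∀ w : DiagonalStrata.reflGroup Φ,
      ∀ v ∈ w • DiagonalStrata.cell Δ I,
        MulAction.stabilizer (DiagonalStrata.reflGroup Φ) v =
          (DiagonalStrata.parabolic (I (Fin.last n))).map (MulAut.conj w).toMonoidHom) ∧
    -- (c)
    (∀ v w : DiagonalStrata.reflGroup Φ,
      ∀ I ∈ DiagonalStrata.chains Φ Δ n, ∀ J ∈ DiagonalStrata.chains Φ Δ n,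
        List.TFAE [
          v • DiagonalStrata.cell Δ I ∩ w • DiagonalStrata.cell Δ J ≠ ∅,
          v • DiagonalStrata.cell Δ I = w • DiagonalStrata.cell Δ J,
          I = J ∧ v⁻¹ * w ∈ DiagonalStrata.parabolic (I (Fin.last n))]) ∧
    -- (d)
    (∀ I ∈ DiagonalStrata.chains Φ Δ n, ∀ w : DiagonalStrata.reflGroup Φ,
      MulAction.stabilizer (DiagonalStrata.reflGroup Φ) (w • DiagonalStrata.cell Δ I) =
        (DiagonalStrata.parabolic (I (Fin.last n))).map (MulAut.conj w).toMonoidHom) ∧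
    -- (e)
    (DiagonalStrata.IsDisjointUnionOfStrata Φ Δ (DiagonalStrata.fundRegion Φ Δ n) ∧
      DiagonalStrata.IsDisjointUnionOfStrata Φ Δ (Set.univ : Set (Fin n → V))) ∧
    -- (f)
    (∀ F ∈ DiagonalStrata.strata Φ Δ n,
      ∃ 𝒢 ⊆ DiagonalStrata.strata Φ Δ n, closure F = ⋃₀ 𝒢) :=
  theorem3p1_general Φ Δ hΦ hΔ n
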